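/- Let $(M,J,g)$ be an almost complex manifold with Norden metric, that is, a smooth manifold $M$ with a smooth almost complex structure $J$ ($J^2=-\mathrm{id}$) and a smooth pseudo-Riemannian metric $g$ such that $g(Jx,Jy)=-g(x,y)$ for all tangent vectors $x,y$ at the same point. Let $\nabla$ be the Levi-Civita connection of $g$, let $R(X,Y)Z=\nabla_X\nabla_YZ-\nabla_Y\nabla_XZ-\nabla_{[X,Y]}Z$ and $R(X,Y,Z,U)=g(R(X,Y)Z,U)$ be its curvature tensors, and let $F(x,y,z)=g\bigl((\nabla_xJ)y,z\bigr)$. Assume that $\dim M\ge 4$ and that $(M,J,g)$ is a $\mathcal W_3$-manifold (a quasi-Kähler manifold with Norden metric), i.e. $$F(x,y,z)+F(y,z,x)+F(z,x,y)=0\qquad\text{for all } x,y,z\in T_pM,\ p\in M.$$ If $R(x,Jx,y,Jy)=0$ for all $x,y\in T_pM$ and all $p\in M$, then $(M,J,g)$ is isotropic Kähler, i.e. at every point $p\in M$ $$\|\nabla J\|^2=g^{ij}g^{kl}\,g\bigl((\nabla_{e_i}J)e_k,(\nabla_{e_j}J)e_l\bigr)=0,$$ where $\{e_i\}$ is any basis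 of $T_pM$ and $(g^{ij})$ is the inverse of the matrix $\bigl(g(e_i,e_j)\bigr)$. -/

import Mathlib

open Bundle FiberBundle Module
open scoped Manifold ContDiff

/-- A smooth pseudo-Riemannian metric on the smooth manifold `M` modelled on `E`: a smooth symmetric
nondegenerate `(0,2)`-tensor field, with no condition on its signature. -/
structure PseudoRiemannianMetric (E : Type*) [NormedAddCommGroup E] [NormedSpace ℝ E]
    (M : Type*) [TopologicalSpace M] [ChartedSpace E M] [IsManifold 𝓘(ℝ, E) ∞ M] where
  /-- The bilinear form on each tangent space. -/
  val (p : M) : TangentSpace 𝓘(ℝ, E) p →L[ℝ] TangentSpace 𝓘(ℝ, E) p →L[ℝ] ℝ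
  symm (p : M) (v w : TangentSpace 𝓘(ℝ, E) p) : val p v w = val p w v
  nondegenerate (p : M) (v : TangentSpace 𝓘(ℝ, E) p)
    (hv : ∀ w : TangentSpace 𝓘(ℝ, E) p, val p v w = 0) : v = 0
  contMDiff : ContMDiff 𝓘(ℝ, E) (𝓘(ℝ, E).prod 𝓘(ℝ, E →L[ℝ] E →L[ℝ] ℝ)) ∞
    (fun p ↦ TotalSpace.mk' (E →L[ℝ] E →L[ℝ] ℝ)
      (E := fun p : M ↦ TangentSpace 𝓘(ℝ, E) p →L[ℝ] TangentSpace 𝓘(ℝ, E) p →L[ℝ] ℝ) p (val p))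

/-- A smooth almost complex structure on `M`: a smooth field of endomorphisms `J` of the tangent
spaces with `J ∘ J = -id`. -/
structure AlmostComplexStructure (E : Type*) [NormedAddCommGroup E] [NormedSpace ℝ E]
    (M : Type*) [TopologicalSpace M] [ChartedSpace E M] [IsManifold 𝓘(ℝ, E) ∞ M] where
  /-- The endomorphism of each tangent space. -/
  val (p : M) : TangentSpace 𝓘(ℝ, E) p →L[ℝ] TangentSpace 𝓘(ℝ, E) p
  sq_eq_neg (p : M) (v : TangentSpace 𝓘(ℝ, E) p) : val p (val p v) = -v
  contMDiff : ContMDiff 𝓘(ℝ, E) (𝓘(ℝ, E).prod 𝓘(ℝ, E →L[ℝ] E)) ∞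
    (fun p ↦ TotalSpace.mk' (E →L[ℝ] E)
      (E := fun p : M ↦ TangentSpace 𝓘(ℝ, E) p →L[ℝ] TangentSpace 𝓘(ℝ, E) p) p (val p))

namespace PseudoRiemannianMetric

variable {E : Type*} [NormedAddCommGroup E] [NormedSpace ℝ E]
  {M : Type*} [TopologicalSpace M] [ChartedSpace E M] [IsManifold 𝓘(ℝ, E) ∞ M]
  (g : PseudoRiemannianMetric E M)

/-- The function `p ↦ g_p(Y_p, Z_p)` for vector fields `Y`, `Z`. -/
noncomputable def pair (Y Z : Π p : M, TangentSpace 𝓘(ℝ, E) p) (p : M) : ℝ := g.val p (Y p) (Z p)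

theorem mdifferentiableAt_pair {Y Z : Π p : M, TangentSpace 𝓘(ℝ, E) p} {p : M}
    (hY : MDiffAt (T% Y) p) (hZ : MDiffAt (T% Z) p) : MDiffAt (g.pair Y Z) p := by
  have : MDifferentiableAt 𝓘(ℝ, E) (𝓘(ℝ, E).prod 𝓘(ℝ))
      (fun m ↦ TotalSpace.mk' ℝ (E := Bundle.Trivial M ℝ) m (g.val m (Y m) (Z m))) p := by
    apply MDifferentiableAt.clm_bundle_apply₂ (F₁ := E) (F₂ := E)
    · exact g.contMDiff.mdifferentiableAt (by simp)
    · exact hY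
    · exact hZ
  simp only [mdifferentiableAt_totalSpace] at this
  exact this.2

/-- The right-hand side of the Koszul formula for `2 g(∇_X Y, Z)`:
`X g(Y,Z) + Y g(X,Z) - Z g(X,Y) + g([X,Y],Z) - g([X,Z],Y) - g([Y,Z],X)`. -/
noncomputable def koszul (X Y Z : Π p : M, TangentSpace 𝓘(ℝ, E) p) (p : M) : ℝ :=
  d% (g.pair Y Z) p (X p) + d% (g.pair X Z) p (Y p) - d% (g.pair X Y) p (Z p)
    + g.val p (VectorField.mlieBracket 𝓘(ℝ, E) X Y p) (Z p)
    - g.val p (VectorField.mlieBracket 𝓘(ℝ, E) X Z p) (Y p)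
    - g.val p (VectorField.mlieBracket 𝓘(ℝ, E) Y Z p) (X p)

theorem pair_add_left (X X' Y : Π p : M, TangentSpace 𝓘(ℝ, E) p) :
    g.pair (X + X') Y = g.pair X Y + g.pair X' Y := by
  ext p; simp [pair]

theorem pair_add_right (X Y Y' : Π p : M, TangentSpace 𝓘(ℝ, E) p) :
    g.pair X (Y + Y') = g.pair X Y + g.pair X Y' := by
  ext p; simp [pair]

theorem pair_smul_left (f : M → ℝ) (X Y : Π p : M, TangentSpace 𝓘(ℝ, E) p) :
    g.pair (f • X) Y = f * g.pair X Y := by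
  ext p; simp [pair]

theorem pair_smul_right (f : M → ℝ) (X Y : Π p : M, TangentSpace 𝓘(ℝ, E) p) :
    g.pair X (f • Y) = f * g.pair X Y := by
  ext p; simp [pair]

theorem pair_comm (X Y : Π p : M, TangentSpace 𝓘(ℝ, E) p) : g.pair X Y = g.pair Y X := by
  ext p; exact g.symm p _ _

theorem eq_of_val_eq {p : M} {v v' : TangentSpace 𝓘(ℝ, E) p}
    (h : ∀ w, g.val p v w = g.val p v' w) : v = v' := by
  rw [← sub_eq_zero]
  refine g.nondegenerate p _ fun w ↦ ?_
  simp [h w]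

variable [FiniteDimensional ℝ E] {g}

theorem tensorial_koszul_left {Y Z : Π p : M, TangentSpace 𝓘(ℝ, E) p} {p : M}
    (hY : MDiffAt (T% Y) p) (hZ : MDiffAt (T% Z) p) :
    TensorialAt 𝓘(ℝ, E) E (fun X ↦ g.koszul X Y Z p) p where
  smul {f X} hf hX := by
    have h1 := g.mdifferentiableAt_pair hX hZ
    have h2 := g.mdifferentiableAt_pair hX hY
    simp only [koszul, pair_smul_left, mvfderiv_mul hf h1, mvfderiv_mul hf h2,
      VectorField.mlieBracket_smul_left hf hX]
    simp [pair, g.symm p (X p)]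
    ring
  add {X X'} hX hX' := by
    have h1 := g.mdifferentiableAt_pair hX hZ
    have h2 := g.mdifferentiableAt_pair hX hY
    have h1' := g.mdifferentiableAt_pair hX' hZ
    have h2' := g.mdifferentiableAt_pair hX' hY
    simp only [koszul, pair_add_left, mvfderiv_add h1 h1', mvfderiv_add h2 h2',
      VectorField.mlieBracket_add_left hX hX']
    simp
    ring

theorem tensorial_koszul_right {X Y : Π p : M, TangentSpace 𝓘(ℝ, E) p} {p : M}
    (hX : MDiffAt (T% X) p) (hY : MDiffAt (T% Y) p) :
    TensorialAt 𝓘(ℝ, E) E (fun Z ↦ g.koszul X Y Z p) p where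
  smul {f Z} hf hZ := by
    have h1 := g.mdifferentiableAt_pair hX hZ
    have h2 := g.mdifferentiableAt_pair hY hZ
    simp only [koszul, pair_smul_right, mvfderiv_mul hf h1, mvfderiv_mul hf h2,
      VectorField.mlieBracket_smul_right hf hZ]
    simp [pair, g.symm p (Z p)]
    ring
  add {Z Z'} hZ hZ' := by
    have h1 := g.mdifferentiableAt_pair hX hZ
    have h2 := g.mdifferentiableAt_pair hY hZ
    have h1' := g.mdifferentiableAt_pair hX hZ'
    have h2' := g.mdifferentiableAt_pair hY hZ'
    simp only [koszul, pair_add_right, mvfderiv_add h1 h1', mvfderiv_add h2 h2',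
      VectorField.mlieBracket_add_right hZ hZ']
    simp
    ring

theorem koszul_add_middle {X Y Y' Z : Π p : M, TangentSpace 𝓘(ℝ, E) p} {p : M}
    (hX : MDiffAt (T% X) p) (hY : MDiffAt (T% Y) p) (hY' : MDiffAt (T% Y') p)
    (hZ : MDiffAt (T% Z) p) :
    g.koszul X (Y + Y') Z p = g.koszul X Y Z p + g.koszul X Y' Z p := by
  simp only [koszul, pair_add_left, pair_add_right,
    mvfderiv_add (g.mdifferentiableAt_pair hX hY) (g.mdifferentiableAt_pair hX hY'),
    mvfderiv_add (g.mdifferentiableAt_pair hY hZ) (g.mdifferentiableAt_pair hY' hZ),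
    VectorField.mlieBracket_add_left hY hY', VectorField.mlieBracket_add_right hY hY']
  simp
  ring

theorem koszul_smul_middle {f : M → ℝ} {X Y Z : Π p : M, TangentSpace 𝓘(ℝ, E) p} {p : M}
    (hf : MDiffAt f p) (hX : MDiffAt (T% X) p) (hY : MDiffAt (T% Y) p) (hZ : MDiffAt (T% Z) p) :
    g.koszul X (f • Y) Z p
      = f p * g.koszul X Y Z p + 2 * (d% f p (X p) * g.val p (Y p) (Z p)) := by
  simp only [koszul, pair_smul_left, pair_smul_right,
    mvfderiv_mul hf (g.mdifferentiableAt_pair hX hY),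
    mvfderiv_mul hf (g.mdifferentiableAt_pair hY hZ),
    VectorField.mlieBracket_smul_left hf hY, VectorField.mlieBracket_smul_right hf hY]
  simp [pair, g.symm p (X p)]
  ring

variable (g)

/-- The musical isomorphism `v ↦ g(v, ·)` from the tangent space to its dual. -/
noncomputable def flat (p : M) :
    TangentSpace 𝓘(ℝ, E) p ≃ₗ[ℝ] (TangentSpace 𝓘(ℝ, E) p →L[ℝ] ℝ) :=
  have : FiniteDimensional ℝ (TangentSpace 𝓘(ℝ, E) p) := inferInstanceAs (FiniteDimensional ℝ E)
  LinearEquiv.ofInjectiveOfFinrankEq (g.val p).toLinearMap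
    (by
      rw [← LinearMap.ker_eq_bot, LinearMap.ker_eq_bot']
      intro v hv
      exact g.nondegenerate p v fun w ↦ congr($hv w))
    (by
      change finrank ℝ E = finrank ℝ (E →L[ℝ] ℝ)
      rw [← (LinearMap.toContinuousLinearMap (𝕜 := ℝ) (E := E) (F' := ℝ)).finrank_eq]
      exact Subspace.dual_finrank_eq.symm)

theorem val_flat_symm (p : M) (φ : TangentSpace 𝓘(ℝ, E) p →L[ℝ] ℝ)
    (w : TangentSpace 𝓘(ℝ, E) p) : g.val p ((g.flat p).symm φ) w = φ w := by
  have h : g.flat p ((g.flat p).symm φ) = φ := LinearEquiv.apply_symm_apply _ _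
  exact congr($h w)

open Classical in
/-- The map `x ↦ ∇_x Y` at the point `p`, determined by the Koszul formula
(and set to `0` if `Y` is not differentiable at `p`). -/
noncomputable def leviCivitaAux (Y : Π p : M, TangentSpace 𝓘(ℝ, E) p) (p : M) :
    TangentSpace 𝓘(ℝ, E) p →L[ℝ] TangentSpace 𝓘(ℝ, E) p :=
  have : FiniteDimensional ℝ (TangentSpace 𝓘(ℝ, E) p) := inferInstanceAs (FiniteDimensional ℝ E)
  have : T2Space (TangentSpace 𝓘(ℝ, E) p) := inferInstanceAs (T2Space E)
  if hY : MDiffAt (T% Y) p then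
    LinearMap.toContinuousLinearMap ((2⁻¹ : ℝ) • ((g.flat p).symm.toLinearMap ∘ₗ
      (TensorialAt.mkHom₂ (I := 𝓘(ℝ, E)) (F := E) (F' := E) (fun X Z ↦ g.koszul X Y Z p) p
        (fun _ hZ ↦ tensorial_koszul_left hY hZ)
        (fun _ hX ↦ tensorial_koszul_right hX hY)).toLinearMap))
  else 0

variable {g} in
theorem two_mul_val_leviCivitaAux {X Y Z : Π p : M, TangentSpace 𝓘(ℝ, E) p} {p : M}
    (hX : MDiffAt (T% X) p) (hY : MDiffAt (T% Y) p) (hZ : MDiffAt (T% Z) p) :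
    2 * g.val p (g.leviCivitaAux Y p (X p)) (Z p) = g.koszul X Y Z p := by
  rw [← TensorialAt.mkHom₂_apply (Φ := fun X Z ↦ g.koszul X Y Z p)
    (fun _ hZ ↦ tensorial_koszul_left hY hZ) (fun _ hX ↦ tensorial_koszul_right hX hY) hX hZ]
  simp [leviCivitaAux, hY, val_flat_symm]

/-- The Levi-Civita connection of `g`, defined by the Koszul formula. As for every
`CovariantDerivative`, `g.leviCivita Y p x` is `∇_x Y` for a tangent vector `x` at `p`. -/
noncomputable def leviCivita : CovariantDerivative 𝓘(ℝ, E) E (TangentSpace 𝓘(ℝ, E) : M → Type _) where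
  toFun := g.leviCivitaAux
  isCovariantDerivativeOnUniv :=
    { add := by
        intro Y Y' p hY hY' _
        ext1 x
        refine g.eq_of_val_eq fun z ↦ ?_
        have hx := mdifferentiableAt_extend 𝓘(ℝ, E) E x
        have hz := mdifferentiableAt_extend 𝓘(ℝ, E) E z
        have h1 := two_mul_val_leviCivitaAux (g := g) hx hY hz
        have h2 := two_mul_val_leviCivitaAux (g := g) hx hY' hz
        have h3 := two_mul_val_leviCivitaAux (g := g) hx (mdifferentiableAt_add_section hY hY') hz
        rw [koszul_add_middle hx hY hY' hz] at h3
        simp only [extend_apply_self] at h1 h2 h3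
        simp only [add_apply, map_add]
        linarith
      leibniz := by
        intro Y f p hY hf _
        ext1 x
        refine g.eq_of_val_eq fun z ↦ ?_
        have hx := mdifferentiableAt_extend 𝓘(ℝ, E) E x
        have hz := mdifferentiableAt_extend 𝓘(ℝ, E) E z
        have h1 := two_mul_val_leviCivitaAux (g := g) hx hY hz
        have h3 := two_mul_val_leviCivitaAux (g := g) hx (hf.smul_section hY) hz
        rw [koszul_smul_middle hf hx hY hz] at h3
        simp only [extend_apply_self] at h1 h3
        simp
        linear_combination h3 / 2 - f p * h1 / 2 }

variable {g}

/-- The Koszul formula. -/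
theorem two_mul_val_leviCivita {X Y Z : Π p : M, TangentSpace 𝓘(ℝ, E) p} {p : M}
    (hX : MDiffAt (T% X) p) (hY : MDiffAt (T% Y) p) (hZ : MDiffAt (T% Z) p) :
    2 * g.val p (g.leviCivita Y p (X p)) (Z p) = g.koszul X Y Z p :=
  two_mul_val_leviCivitaAux hX hY hZ

/-- The Levi-Civita connection is torsion-free. -/
theorem leviCivita_torsion_free {X Y : Π p : M, TangentSpace 𝓘(ℝ, E) p} {p : M}
    (hX : MDiffAt (T% X) p) (hY : MDiffAt (T% Y) p) :
    g.leviCivita Y p (X p) - g.leviCivita X p (Y p) = VectorField.mlieBracket 𝓘(ℝ, E) X Y p := by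
  refine g.eq_of_val_eq fun z ↦ ?_
  have hz := mdifferentiableAt_extend 𝓘(ℝ, E) E z
  have h1 := two_mul_val_leviCivita (g := g) hX hY hz
  have h2 := two_mul_val_leviCivita (g := g) hY hX hz
  have h3 := VectorField.mlieBracket_swap_apply (I := 𝓘(ℝ, E)) (V := Y) (W := X) (x := p)
  simp only [koszul, extend_apply_self, g.pair_comm Y X, h3, map_neg, neg_apply] at h1 h2
  simp only [map_sub, sub_apply]
  linarith

/-- The Levi-Civita connection is compatible with the metric. -/
theorem mvfderiv_pair_eq {X Y Z : Π p : M, TangentSpace 𝓘(ℝ, E) p} {p : M}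
    (hX : MDiffAt (T% X) p) (hY : MDiffAt (T% Y) p) (hZ : MDiffAt (T% Z) p) :
    d% (g.pair Y Z) p (X p)
      = g.val p (g.leviCivita Y p (X p)) (Z p) + g.val p (Y p) (g.leviCivita Z p (X p)) := by
  have h1 := two_mul_val_leviCivita (g := g) hX hY hZ
  have h2 := two_mul_val_leviCivita (g := g) hX hZ hY
  have h3 := VectorField.mlieBracket_swap_apply (I := 𝓘(ℝ, E)) (V := Z) (W := Y) (x := p)
  simp only [koszul, g.pair_comm Z Y, h3, map_neg, neg_apply] at h1 h2
  rw [g.symm p (Y p)]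
  linarith

variable (g)

/-- The curvature tensor `R(x, y)z = ∇_X ∇_Y Z - ∇_Y ∇_X Z - ∇_[X, Y] Z` of type `(1,3)`, where
`X`, `Y`, `Z` are local smooth vector fields which extend `x`, `y`, `z`. (The expression is
tensorial, so that the choice of the extensions does not matter.) -/
noncomputable def curvature (p : M) (x y z : TangentSpace 𝓘(ℝ, E) p) : TangentSpace 𝓘(ℝ, E) p :=
  let X : Π q : M, TangentSpace 𝓘(ℝ, E) q := extend E x
  let Y : Π q : M, TangentSpace 𝓘(ℝ, E) q := extend E y
  let Z : Π q : M, TangentSpace 𝓘(ℝ, E) q := extend E z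
  g.leviCivita (fun q ↦ g.leviCivita Z q (Y q)) p (X p)
    - g.leviCivita (fun q ↦ g.leviCivita Z q (X q)) p (Y p)
    - g.leviCivita Z p (VectorField.mlieBracket 𝓘(ℝ, E) X Y p)

/-- The curvature tensor `R(x, y, z, u) = g(R(x, y)z, u)` of type `(0,4)`. -/
noncomputable def curvature₄ (p : M) (x y z u : TangentSpace 𝓘(ℝ, E) p) : ℝ :=
  g.val p (g.curvature p x y z) u

/-- The matrix of `g` at `p` with respect to a basis of the tangent space; the entries of its
inverse are the components `g^{ij}`. -/
noncomputable def gram {p : M} {ι : Type*} (b : Basis ι ℝ (TangentSpace 𝓘(ℝ, E) p)) :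
    Matrix ι ι ℝ :=
  Matrix.of fun i j ↦ g.val p (b i) (b j)

variable (J : AlmostComplexStructure E M)

/-- `g` is a Norden metric for `J`, that is `g(Jx, Jy) = -g(x, y)`. -/
def IsNorden : Prop :=
  ∀ (p : M) (x y : TangentSpace 𝓘(ℝ, E) p), g.val p (J.val p x) (J.val p y) = -g.val p x y

/-- `(∇_x J)y = ∇_x (JY) - J ∇_x Y`, where `Y` is a local smooth vector field which extends `y`.
(The expression is tensorial, so that the choice of the extension does not matter.) -/
noncomputable def nablaJ (p : M) (x y : TangentSpace 𝓘(ℝ, E) p) : TangentSpace 𝓘(ℝ, E) p :=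
  let Y : Π q : M, TangentSpace 𝓘(ℝ, E) q := extend E y
  g.leviCivita (fun q ↦ J.val q (Y q)) p x - J.val p (g.leviCivita Y p x)

/-- The definition of `∇J` does not depend on the choice of the extension. -/
theorem nablaJ_apply {p : M} (x : TangentSpace 𝓘(ℝ, E) p) {Y : Π q : M, TangentSpace 𝓘(ℝ, E) q}
    (hY : MDiffAt (T% Y) p) :
    g.nablaJ J p x (Y p)
      = g.leviCivita (fun q ↦ J.val q (Y q)) p x - J.val p (g.leviCivita Y p x) := by
  have hJ : ∀ {Y : Π q : M, TangentSpace 𝓘(ℝ, E) q}, MDiffAt (T% Y) p →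
      MDiffAt (T% (fun q ↦ J.val q (Y q))) p := fun hY ↦
    MDifferentiableAt.clm_bundle_apply (F₁ := E) (F₂ := E)
      (J.contMDiff.mdifferentiableAt (by simp)) hY
  have key : TensorialAt 𝓘(ℝ, E) E (fun Y : Π q : M, TangentSpace 𝓘(ℝ, E) q ↦
      g.leviCivita (fun q ↦ J.val q (Y q)) p x - J.val p (g.leviCivita Y p x)) p :=
    { smul := by
        intro f Y hf hY
        have h1 : (fun q ↦ J.val q ((f • Y) q)) = f • fun q ↦ J.val q (Y q) := by
          ext q; simp
        rw [h1, g.leviCivita.isCovariantDerivativeOnUniv.leibniz hY hf,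
          g.leviCivita.isCovariantDerivativeOnUniv.leibniz (hJ hY) hf]
        simp
        module
      add := by
        intro Y Y' hY hY'
        have h1 : (fun q ↦ J.val q ((Y + Y') q))
            = (fun q ↦ J.val q (Y q)) + fun q ↦ J.val q (Y' q) := by
          ext q; simp
        rw [h1, g.leviCivita.isCovariantDerivativeOnUniv.add hY hY',
          g.leviCivita.isCovariantDerivativeOnUniv.add (hJ hY) (hJ hY')]
        simp
        module }
  exact key.pointwise (mdifferentiableAt_extend 𝓘(ℝ, E) E (Y p)) hY (by simp)

/-- The tensor `F(x, y, z) = g((∇_x J)y, z)`. -/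
noncomputable def fundamentalTensor (p : M) (x y z : TangentSpace 𝓘(ℝ, E) p) : ℝ :=
  g.val p (g.nablaJ J p x y) z

/-- The condition defining the class `𝒲₃` (quasi-Kähler manifolds with Norden metric) among the
almost complex manifolds with Norden metric: the cyclic sum of `F(x, y, z)` vanishes. -/
def IsW₃ : Prop :=
  ∀ (p : M) (x y z : TangentSpace 𝓘(ℝ, E) p),
    g.fundamentalTensor J p x y z + g.fundamentalTensor J p y z x
      + g.fundamentalTensor J p z x y = 0

/-- The square norm `‖∇J‖² = g^{ij} g^{kl} g((∇_{e_i} J)e_k, (∇_{e_j} J)e_l)` at `p`, computed in a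
basis `e` of the tangent space. -/
noncomputable def sqNormNablaJ {p : M} {ι : Type*} [Fintype ι] [DecidableEq ι]
    (e : Basis ι ℝ (TangentSpace 𝓘(ℝ, E) p)) : ℝ :=
  ∑ i, ∑ j, ∑ k, ∑ l, (g.gram e)⁻¹ i j * (g.gram e)⁻¹ k l
    * g.val p (g.nablaJ J p (e i) (e k)) (g.nablaJ J p (e j) (e l))

/-- The isotropic Kähler condition: `‖∇J‖²` vanishes at every point (in whichever basis it is
computed). -/
def IsIsotropicKahler : Prop :=
  ∀ (p : M) (e : Basis (Fin (finrank ℝ E)) ℝ (TangentSpace 𝓘(ℝ, E) p)), g.sqNormNablaJ J e = 0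

end PseudoRiemannianMetric

/-! ### Smooth vector fields acting on functions -/

section VectorFields

variable {E : Type*} [NormedAddCommGroup E] [NormedSpace ℝ E] [FiniteDimensional ℝ E]
  {M : Type*} [TopologicalSpace M] [ChartedSpace E M] [IsManifold 𝓘(ℝ, E) ∞ M]
  {p : M} {X Y : Π p : M, TangentSpace 𝓘(ℝ, E) p} {f : M → ℝ}

/-! The proof has a differential half and an algebraic half, joined by the quantity g((∇_x J)x, (∇_x
J)x).

Differential half (`curvature₄_holomorphic`): the curvature is g-skew, so -2R(x,Jx,x,Jx) =
g(R(X,Y)JX, X) - g(R(X,Y)X, JX), where X and Y extend x and Jx. Since F(u,X,z) = g(∇_u(JX), z) -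
g(∇_u X, Jz), the second derivatives on the right come from differentiating F(Y,X,X) along X and
F(X,X,X) along Y. The 𝒲₃ condition gives F(X,X,X) = 0 and F(Y,X,X) = -2F(X,X,Y), while F(X,X,JX) = 0
holds for any Norden metric; these remove all second derivatives. The first-order terms collapse to
R(x,Jx,x,Jx) = -g((∇_x J)x, (∇_x J)x). The hypothesis at y = x therefore makes every (∇_x J)x null.

Algebraic half (`sum_apply_apply_dual_eq_zero`): fix a point and write A(x,y) = (∇_x J)y. Polarize
the quartic identity g(A(x,x), A(x,x)) = 0 and contract it with the inverse metric in two pairs of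
slots. With N = ‖∇J‖² and N* the same contraction with the two arguments of the second factor
exchanged, this gives N + N* = 0, because the metric trace of A vanishes. Contracting the cyclic
identity against F gives N + 2N* = 0. Hence N = 0.

The differential half differentiates ∇_Y Z again, so smoothness of the connection and the commutator
formula for [X,Y] acting on functions are established beforehand. -/

theorem contMDiffAt_infty_mlieBracket (hX : CMDiffAt ∞ (T% X) p) (hY : CMDiffAt ∞ (T% Y) p) :
    CMDiffAt ∞ (T% (VectorField.mlieBracket 𝓘(ℝ, E) X Y)) p := by
  have : IsManifold 𝓘(ℝ, E) (((⊤ : ℕ∞) : WithTop ℕ∞) + 1) M := by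
    simpa using (inferInstance : IsManifold 𝓘(ℝ, E) ∞ M)
  have : IsManifold 𝓘(ℝ, E) (minSmoothness ℝ 2) M :=
    IsManifold.of_le (n := ∞) (by
      rw [minSmoothness_of_isRCLikeNormedField]
      exact WithTop.coe_le_coe.2 (le_top : (2 : ℕ∞) ≤ ⊤))
  exact ContMDiffAt.mlieBracket_vectorField (m := ⊤) (n := ⊤) hX hY (by simp)

/-- By the Leibniz rule (Xf)Z = [X, fZ] - f[X, Z]. With Z a local frame field, Xf is a frame
coefficient of a smooth field. -/
theorem contMDiffAt_mvfderiv_apply (hf : CMDiffAt ∞ f p) (hX : CMDiffAt ∞ (T% X) p) :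
    CMDiffAt ∞ (fun q ↦ d% f q (X q)) p := by
  rcases subsingleton_or_nontrivial E with hE | hE
  · have h0 : (fun q ↦ d% f q (X q)) = fun _ ↦ (0 : ℝ) := by
      ext q
      have : X q = 0 := Subsingleton.elim (α := E) _ _
      simp [this]
    rw [h0]
    exact contMDiffAt_const
  let b := finBasis ℝ E
  have hpos : 0 < finrank ℝ E := finrank_pos
  let i : Fin (finrank ℝ E) := ⟨0, hpos⟩
  let e := trivializationAt E (TangentSpace 𝓘(ℝ, E) : M → Type _) p
  have hp : p ∈ e.baseSet := FiberBundle.mem_baseSet_trivializationAt' p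
  have hZ : CMDiffAt ∞ (T% (e.localFrame b i)) p := contMDiffAt_localFrame_of_mem _ _ b i hp
  have h1 : CMDiffAt ∞ (T% (VectorField.mlieBracket 𝓘(ℝ, E) X (f • e.localFrame b i)
      - f • VectorField.mlieBracket 𝓘(ℝ, E) X (e.localFrame b i))) p :=
    (contMDiffAt_infty_mlieBracket hX (hf.smul_section hZ)).sub_section
      (hf.smul_section (contMDiffAt_infty_mlieBracket hX hZ))
  refine ((contMDiffAt_iff_localFrameCoeff (I := 𝓘(ℝ, E)) (e := e) b hp).1 h1 i).congr_of_eventuallyEq ?_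
  have hf1 : ∀ᶠ q in nhds p, CMDiffAt 1 f q :=
    (contMDiffAt_iff_contMDiffAt_nhds (by simp)).1 (hf.of_le (by simp))
  filter_upwards [e.open_baseSet.mem_nhds hp, hf1] with q hq hfq
  have hZq : CMDiffAt 1 (T% (e.localFrame b i)) q := contMDiffAt_localFrame_of_mem _ _ b i hq
  simp [LinearMap.piApply, VectorField.mlieBracket_smul_right (hfq.mdifferentiableAt (by simp))
    (hZq.mdifferentiableAt (by simp))]
  rw [Trivialization.localFrameCoeff_apply_of_mem_baseSet (I := 𝓘(ℝ, E)) e b hq]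
  simp [hq]

omit [FiniteDimensional ℝ E] in
theorem eventually_mdifferentiableAt (hX : CMDiffAt ∞ (T% X) p) :
    ∀ᶠ q in nhds p, MDiffAt (T% X) q :=
  ((contMDiffAt_iff_contMDiffAt_nhds (by simp)).1 (hX.of_le (m := 1) (by simp))).mono
    fun _ h ↦ h.mdifferentiableAt (by simp)

omit [FiniteDimensional ℝ E] in
theorem eventually_mdifferentiableAt_fun (hf : CMDiffAt ∞ f p) :
    ∀ᶠ q in nhds p, MDiffAt f q :=
  ((contMDiffAt_iff_contMDiffAt_nhds (by simp)).1 (hf.of_le (m := 1) (by simp))).mono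
    fun _ h ↦ h.mdifferentiableAt (by simp)

/-- The Lie bracket of vector fields is the commutator of the derivations. -/
theorem mvfderiv_mlieBracket (hf : CMDiffAt ∞ f p) (hX : CMDiffAt ∞ (T% X) p)
    (hY : CMDiffAt ∞ (T% Y) p) :
    d% f p (VectorField.mlieBracket 𝓘(ℝ, E) X Y p)
      = d% (fun q ↦ d% f q (Y q)) p (X p) - d% (fun q ↦ d% f q (X q)) p (Y p) := by
  rcases subsingleton_or_nontrivial E with hE | hE
  · have h0 : ∀ v : TangentSpace 𝓘(ℝ, E) p, v = 0 := fun v ↦ Subsingleton.elim (α := E) _ _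
    simp [h0]
  have : IsManifold 𝓘(ℝ, E) (minSmoothness ℝ 3) M :=
    IsManifold.of_le (n := ∞) (by
      rw [minSmoothness_of_isRCLikeNormedField]
      exact WithTop.coe_le_coe.2 (le_top : (3 : ℕ∞) ≤ ⊤))
  obtain ⟨v, hv⟩ : ∃ v : TangentSpace 𝓘(ℝ, E) p, v ≠ 0 := exists_ne (α := E) 0
  let Z : Π q : M, TangentSpace 𝓘(ℝ, E) q := extend E v
  have hZ : CMDiffAt ∞ (T% Z) p := contMDiffAt_extend 𝓘(ℝ, E) E v
  have hZv : Z p = v := extend_apply_self E v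
  have key : ∀ {U V : Π p : M, TangentSpace 𝓘(ℝ, E) p}, CMDiffAt ∞ (T% U) p →
      CMDiffAt ∞ (T% V) p →
      VectorField.mlieBracket 𝓘(ℝ, E) U (VectorField.mlieBracket 𝓘(ℝ, E) V (f • Z)) p
        = d% (fun q ↦ d% f q (V q)) p (U p) • v
          + d% f p (V p) • VectorField.mlieBracket 𝓘(ℝ, E) U Z p
          + (d% f p (U p) • VectorField.mlieBracket 𝓘(ℝ, E) V Z p
          + f p • VectorField.mlieBracket 𝓘(ℝ, E) U (VectorField.mlieBracket 𝓘(ℝ, E) V Z) p) := by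
    intro U V hU hV
    have hVf := contMDiffAt_mvfderiv_apply hf hV
    have hVZ := contMDiffAt_infty_mlieBracket hV hZ
    have h1 : VectorField.mlieBracket 𝓘(ℝ, E) V (f • Z) =ᶠ[nhds p]
        (fun q ↦ d% f q (V q)) • Z + f • VectorField.mlieBracket 𝓘(ℝ, E) V Z := by
      filter_upwards [eventually_mdifferentiableAt_fun hf, eventually_mdifferentiableAt hZ]
        with q hq hq'
      rw [VectorField.mlieBracket_smul_right hq hq']
      rfl
    have h2 := Filter.EventuallyEq.mlieBracket_vectorField_eq (Filter.EventuallyEq.refl _ U) h1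
    rw [h2,
      VectorField.mlieBracket_add_right ((hVf.smul_section hZ).mdifferentiableAt (by simp))
        ((hf.smul_section hVZ).mdifferentiableAt (by simp)),
      VectorField.mlieBracket_smul_right (hVf.mdifferentiableAt (by simp))
        (hZ.mdifferentiableAt (by simp)),
      VectorField.mlieBracket_smul_right (hf.mdifferentiableAt (by simp))
        (hVZ.mdifferentiableAt (by simp)), hZv]
  have hle : minSmoothness ℝ 2 ≤ (∞ : WithTop ℕ∞) := by
    rw [minSmoothness_of_isRCLikeNormedField]
    exact WithTop.coe_le_coe.2 (le_top : (2 : ℕ∞) ≤ ⊤)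
  -- Compare the Jacobi identities for fZ and for Z: the mixed first-order terms in `key` are
  -- symmetric in U and V and cancel, leaving a multiple of Z(p) = v ≠ 0 whose coefficient is the
  -- desired difference.
  have h1 := VectorField.leibniz_identity_mlieBracket_apply (hX.of_le hle) (hY.of_le hle)
    ((hf.smul_section hZ).of_le hle)
  have h2 := VectorField.leibniz_identity_mlieBracket_apply (hX.of_le hle) (hY.of_le hle)
    (hZ.of_le hle)
  rw [key hX hY, key hY hX, VectorField.mlieBracket_smul_right (hf.mdifferentiableAt (by simp))
    (hZ.mdifferentiableAt (by simp)), hZv, h2] at h1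
  have h3 : (d% f p (VectorField.mlieBracket 𝓘(ℝ, E) X Y p) - (d% (fun q ↦ d% f q (Y q)) p (X p)
      - d% (fun q ↦ d% f q (X q)) p (Y p))) • v = 0 := by
    rw [← sub_eq_zero, ← neg_eq_zero] at h1
    rw [← h1]
    module
  exact sub_eq_zero.1 ((smul_eq_zero.1 h3).resolve_right hv)

end VectorFields

/-! ### Linear systems with smooth coefficients -/

section Cramer

variable {E : Type*} [NormedAddCommGroup E] [NormedSpace ℝ E]
  {M : Type*} [TopologicalSpace M] [ChartedSpace E M] {p : M}
  {ι : Type*} [Fintype ι] [DecidableEq ι]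

theorem contMDiffAt_det {A : M → Matrix ι ι ℝ} (hA : ∀ i j, CMDiffAt ∞ (fun q ↦ A q i j) p) :
    CMDiffAt ∞ (fun q ↦ (A q).det) p := by
  simp only [Matrix.det_apply, Units.smul_def, zsmul_eq_mul]
  exact contMDiffAt_finsetSum fun σ _ ↦ contMDiffAt_const.mul
    (contMDiffAt_finsetProd fun i _ ↦ hA _ _)

/-- Cramer's rule writes each unknown as a quotient of determinants, with nonvanishing denominator
near p. -/
theorem contMDiffAt_of_mulVec {A : M → Matrix ι ι ℝ} {v w : M → ι → ℝ}
    (hA : ∀ i j, CMDiffAt ∞ (fun q ↦ A q i j) p) (hp : (A p).det ≠ 0)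
    (hw : ∀ i, CMDiffAt ∞ (fun q ↦ w q i) p) (hv : ∀ᶠ q in nhds p, (A q).mulVec (v q) = w q) (i : ι) :
    CMDiffAt ∞ (fun q ↦ v q i) p := by
  have hdet := contMDiffAt_det hA
  have hcr : CMDiffAt ∞ (fun q ↦ (A q).cramer (w q) i) p := by
    simp only [Matrix.cramer_apply]
    refine contMDiffAt_det fun k l ↦ ?_
    by_cases h : l = i
    · simpa [Matrix.updateCol_apply, h] using hw k
    · simpa [Matrix.updateCol_apply, h] using hA k l
  refine ((hdet.inv₀ hp).mul hcr).congr_of_eventuallyEq ?_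
  filter_upwards [hv, hdet.continuousAt.eventually_ne hp] with q hq hq'
  rw [Pi.mul_apply, eq_inv_mul_iff_mul_eq₀ hq', ← hq, Matrix.cramer_eq_adjugate_mulVec,
    Matrix.mulVec_mulVec, Matrix.adjugate_mul, Matrix.smul_mulVec, Matrix.one_mulVec]
  rfl

end Cramer

/-! ### Smoothness of the Levi-Civita connection -/

namespace PseudoRiemannianMetric

variable {E : Type*} [NormedAddCommGroup E] [NormedSpace ℝ E]
  {M : Type*} [TopologicalSpace M] [ChartedSpace E M] [IsManifold 𝓘(ℝ, E) ∞ M]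
  (g : PseudoRiemannianMetric E M) {p : M} {X Y Z : Π p : M, TangentSpace 𝓘(ℝ, E) p}

theorem contMDiffAt_pair (hY : CMDiffAt ∞ (T% Y) p) (hZ : CMDiffAt ∞ (T% Z) p) :
    CMDiffAt ∞ (g.pair Y Z) p := by
  have : ContMDiffAt 𝓘(ℝ, E) (𝓘(ℝ, E).prod 𝓘(ℝ)) ∞
      (fun m ↦ TotalSpace.mk' ℝ (E := Bundle.Trivial M ℝ) m (g.val m (Y m) (Z m))) p := by
    apply ContMDiffAt.clm_bundle_apply₂ (F₁ := E) (F₂ := E)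
    · exact g.contMDiff.contMDiffAt
    · exact hY
    · exact hZ
  simp only [contMDiffAt_totalSpace] at this
  exact this.2

variable [FiniteDimensional ℝ E]

/-- A vector field is smooth if its pairings with all smooth vector fields are. -/
theorem contMDiffAt_of_pair
    (h : ∀ Z : Π p : M, TangentSpace 𝓘(ℝ, E) p, CMDiffAt ∞ (T% Z) p → CMDiffAt ∞ (g.pair Y Z) p) :
    CMDiffAt ∞ (T% Y) p := by
  let b := finBasis ℝ E
  let e := trivializationAt E (TangentSpace 𝓘(ℝ, E) : M → Type _) p
  have hp : p ∈ e.baseSet := FiberBundle.mem_baseSet_trivializationAt' p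
  have hZ : ∀ i, CMDiffAt ∞ (T% (e.localFrame b i)) p :=
    fun i ↦ contMDiffAt_localFrame_of_mem _ _ b i hp
  refine (contMDiffAt_iff_localFrameCoeff (I := 𝓘(ℝ, E)) (e := e) b hp).2 ?_
  -- The frame coefficients of Y solve a linear system whose matrix is the Gram matrix of the frame,
  -- invertible at p by nondegeneracy.
  refine contMDiffAt_of_mulVec
    (A := fun q ↦ Matrix.of fun i j ↦ g.pair (e.localFrame b j) (e.localFrame b i) q)
    (v := fun q i ↦ LinearMap.piApply (e.localFrameCoeff 𝓘(ℝ, E) b i) Y q)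
    (w := fun q i ↦ g.pair Y (e.localFrame b i) q) (fun i j ↦ g.contMDiffAt_pair (hZ _) (hZ _)) ?_
    (fun i ↦ h _ (hZ i)) ?_
  · intro hdet
    obtain ⟨v, hv, hv'⟩ := Matrix.exists_mulVec_eq_zero_iff.2 hdet
    apply hv
    have h0 : ∑ j, v j • e.basisAt b hp j = 0 := by
      refine g.nondegenerate p _ fun w ↦ ?_
      rw [← (e.basisAt b hp).sum_repr w]
      have h1 : ∀ i, ∑ j, v j * g.val p (e.basisAt b hp j) (e.basisAt b hp i) = 0 := by
        intro i
        have := congr_fun hv' i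
        simpa [Matrix.mulVec, dotProduct, pair, hp, mul_comm] using this
      simp only [map_sum, map_smul, sum_apply, smul_apply,
        smul_eq_mul, h1]
      simp
    ext j
    exact (Fintype.linearIndependent_iff.1 (e.basisAt b hp).linearIndependent) v h0 j
  · filter_upwards [e.open_baseSet.mem_nhds hp] with q hq
    ext i
    have h1 := Trivialization.eq_sum_localFrameCoeff_smul (I := 𝓘(ℝ, E)) (b := b) (s := Y) hq
    simp only [Matrix.mulVec, dotProduct, pair, Matrix.of_apply, LinearMap.piApply]
    conv_rhs => rw [h1]
    simp [mul_comm]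

theorem contMDiffAt_koszul (hX : CMDiffAt ∞ (T% X) p) (hY : CMDiffAt ∞ (T% Y) p)
    (hZ : CMDiffAt ∞ (T% Z) p) : CMDiffAt ∞ (g.koszul X Y Z) p :=
  (((((contMDiffAt_mvfderiv_apply (g.contMDiffAt_pair hY hZ) hX).add
    (contMDiffAt_mvfderiv_apply (g.contMDiffAt_pair hX hZ) hY)).sub
    (contMDiffAt_mvfderiv_apply (g.contMDiffAt_pair hX hY) hZ)).add
    (g.contMDiffAt_pair (contMDiffAt_infty_mlieBracket hX hY) hZ)).sub
    (g.contMDiffAt_pair (contMDiffAt_infty_mlieBracket hX hZ) hY)).sub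
    (g.contMDiffAt_pair (contMDiffAt_infty_mlieBracket hY hZ) hX)

/-- The covariant derivative of a smooth vector field along a smooth vector field is smooth. -/
theorem contMDiffAt_leviCivita (hX : CMDiffAt ∞ (T% X) p) (hY : CMDiffAt ∞ (T% Y) p) :
    CMDiffAt ∞ (T% (fun q ↦ g.leviCivita Y q (X q))) p := by
  -- By the Koszul formula the pairing with Z is, near p, half of a smooth expression.
  refine g.contMDiffAt_of_pair fun Z hZ ↦ ?_
  refine ((contMDiffAt_const (c := (2⁻¹ : ℝ))).mul
    (g.contMDiffAt_koszul hX hY hZ)).congr_of_eventuallyEq ?_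
  filter_upwards [eventually_mdifferentiableAt hX, eventually_mdifferentiableAt hY,
    eventually_mdifferentiableAt hZ] with q h1 h2 h3
  have := two_mul_val_leviCivita (g := g) h1 h2 h3
  simp only [pair, Pi.mul_apply]
  linarith

end PseudoRiemannianMetric

/-! ### Curvature and the tensor ∇J -/

namespace PseudoRiemannianMetric

variable {E : Type*} [NormedAddCommGroup E] [NormedSpace ℝ E] [FiniteDimensional ℝ E]
  {M : Type*} [TopologicalSpace M] [ChartedSpace E M] [IsManifold 𝓘(ℝ, E) ∞ M]
  {g : PseudoRiemannianMetric E M} {J : AlmostComplexStructure E M}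
  {p : M} {X Y Z U V : Π p : M, TangentSpace 𝓘(ℝ, E) p}

omit [FiniteDimensional ℝ E] [IsManifold 𝓘(ℝ, E) ∞ M] in
theorem mvfderiv_congr {f f' : M → ℝ} (h : f =ᶠ[nhds p] f') : d% f p = d% f' p := by
  ext v
  exact congr($(h.mfderiv_eq) v)

/-- The curvature operator is skew-symmetric with respect to the metric. -/
theorem val_curvature_skew (hX : CMDiffAt ∞ (T% X) p) (hY : CMDiffAt ∞ (T% Y) p)
    (hU : CMDiffAt ∞ (T% U) p) (hV : CMDiffAt ∞ (T% V) p) :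
    g.val p (g.leviCivita (fun q ↦ g.leviCivita U q (Y q)) p (X p)
        - g.leviCivita (fun q ↦ g.leviCivita U q (X q)) p (Y p)
        - g.leviCivita U p (VectorField.mlieBracket 𝓘(ℝ, E) X Y p)) (V p)
      + g.val p (U p) (g.leviCivita (fun q ↦ g.leviCivita V q (Y q)) p (X p)
        - g.leviCivita (fun q ↦ g.leviCivita V q (X q)) p (Y p)
        - g.leviCivita V p (VectorField.mlieBracket 𝓘(ℝ, E) X Y p)) = 0 := by
  -- Metric compatibility applied twice to g(U,V). The two cross terms are symmetric in X and Y, so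
  -- they disappear from the commutator.
  have key : ∀ {X Y : Π p : M, TangentSpace 𝓘(ℝ, E) p}, CMDiffAt ∞ (T% X) p →
      CMDiffAt ∞ (T% Y) p →
      d% (fun q ↦ d% (g.pair U V) q (Y q)) p (X p)
        = g.val p (g.leviCivita (fun q ↦ g.leviCivita U q (Y q)) p (X p)) (V p)
          + g.val p (g.leviCivita U p (Y p)) (g.leviCivita V p (X p))
          + (g.val p (g.leviCivita U p (X p)) (g.leviCivita V p (Y p))
          + g.val p (U p) (g.leviCivita (fun q ↦ g.leviCivita V q (Y q)) p (X p))) := by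
    intro X Y hX hY
    have h1 : (fun q ↦ d% (g.pair U V) q (Y q)) =ᶠ[nhds p]
        g.pair (fun q ↦ g.leviCivita U q (Y q)) V + g.pair U (fun q ↦ g.leviCivita V q (Y q)) := by
      filter_upwards [eventually_mdifferentiableAt hY, eventually_mdifferentiableAt hU,
        eventually_mdifferentiableAt hV] with q h1 h2 h3
      exact mvfderiv_pair_eq h1 h2 h3
    have hYU := g.contMDiffAt_leviCivita hY hU
    have hYV := g.contMDiffAt_leviCivita hY hV
    have h2 : d% (fun q ↦ d% (g.pair U V) q (Y q)) p = d% (g.pair (fun q ↦ g.leviCivita U q (Y q)) V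
        + g.pair U (fun q ↦ g.leviCivita V q (Y q))) p :=
      mvfderiv_congr h1
    rw [h2, mvfderiv_add ((g.contMDiffAt_pair hYU hV).mdifferentiableAt (by simp))
      ((g.contMDiffAt_pair hU hYV).mdifferentiableAt (by simp)), add_apply,
      mvfderiv_pair_eq (hX.mdifferentiableAt (by simp)) (hYU.mdifferentiableAt (by simp))
        (hV.mdifferentiableAt (by simp)),
      mvfderiv_pair_eq (hX.mdifferentiableAt (by simp)) (hU.mdifferentiableAt (by simp))
        (hYV.mdifferentiableAt (by simp))]
  have hB := contMDiffAt_infty_mlieBracket hX hY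
  have h1 := mvfderiv_mlieBracket (g.contMDiffAt_pair hU hV) hX hY
  rw [key hX hY, key hY hX, mvfderiv_pair_eq (hB.mdifferentiableAt (by simp))
    (hU.mdifferentiableAt (by simp)) (hV.mdifferentiableAt (by simp))] at h1
  simp only [map_sub, sub_apply]
  linarith

omit [FiniteDimensional ℝ E] in
theorem contMDiffAt_pair_sub_pair {A B C D : Π p : M, TangentSpace 𝓘(ℝ, E) p}
    (hA : CMDiffAt ∞ (T% A) p) (hB : CMDiffAt ∞ (T% B) p)
    (hC : CMDiffAt ∞ (T% C) p) (hD : CMDiffAt ∞ (T% D) p) :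
    CMDiffAt ∞ (g.pair A B - g.pair C D) p :=
  (g.contMDiffAt_pair hA hB).sub (g.contMDiffAt_pair hC hD)

/-- F(u, X, z) is a difference of two pairings of exactly this form, so this serves to differentiate
identities for F. -/
theorem mvfderiv_pair_sub_pair {A B C D : Π p : M, TangentSpace 𝓘(ℝ, E) p}
    (hX : CMDiffAt ∞ (T% X) p) (hA : CMDiffAt ∞ (T% A) p) (hB : CMDiffAt ∞ (T% B) p)
    (hC : CMDiffAt ∞ (T% C) p) (hD : CMDiffAt ∞ (T% D) p) :
    d% (g.pair A B - g.pair C D) p (X p)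
      = g.val p (g.leviCivita A p (X p)) (B p) + g.val p (A p) (g.leviCivita B p (X p))
        - (g.val p (g.leviCivita C p (X p)) (D p) + g.val p (C p) (g.leviCivita D p (X p))) := by
  have hn : (∞ : WithTop ℕ∞) ≠ 0 := by simp
  rw [mvfderiv_sub ((g.contMDiffAt_pair hA hB).mdifferentiableAt hn)
    ((g.contMDiffAt_pair hC hD).mdifferentiableAt hn), sub_apply,
    mvfderiv_pair_eq (hX.mdifferentiableAt hn) (hA.mdifferentiableAt hn) (hB.mdifferentiableAt hn),
    mvfderiv_pair_eq (hX.mdifferentiableAt hn) (hC.mdifferentiableAt hn) (hD.mdifferentiableAt hn)]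

omit [FiniteDimensional ℝ E] [IsManifold 𝓘(ℝ, E) ∞ M] in
theorem mvfderiv_eq_zero_of_eventuallyEq {f : M → ℝ} (h : f =ᶠ[nhds p] 0) : d% f p = 0 := by
  rw [mvfderiv_congr h, mvfderiv_zero]

omit [FiniteDimensional ℝ E] in
theorem contMDiffAt_almostComplex (hY : CMDiffAt ∞ (T% Y) p) :
    CMDiffAt ∞ (T% (fun q ↦ J.val q (Y q))) p :=
  ContMDiffAt.clm_bundle_apply (F₁ := E) (F₂ := E) J.contMDiff.contMDiffAt hY

omit [FiniteDimensional ℝ E] in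
theorem mdifferentiableAt_almostComplex (hY : MDiffAt (T% Y) p) :
    MDiffAt (T% (fun q ↦ J.val q (Y q))) p :=
  MDifferentiableAt.clm_bundle_apply (F₁ := E) (F₂ := E)
    (J.contMDiff.mdifferentiableAt (by simp)) hY

theorem nablaJ_add_left (x x' y : TangentSpace 𝓘(ℝ, E) p) :
    g.nablaJ J p (x + x') y = g.nablaJ J p x y + g.nablaJ J p x' y := by
  simp only [nablaJ, map_add]
  abel

theorem nablaJ_smul_left (c : ℝ) (x y : TangentSpace 𝓘(ℝ, E) p) :
    g.nablaJ J p (c • x) y = c • g.nablaJ J p x y := by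
  simp only [nablaJ, map_smul, smul_sub]

theorem nablaJ_add_right (x y y' : TangentSpace 𝓘(ℝ, E) p) :
    g.nablaJ J p x (y + y') = g.nablaJ J p x y + g.nablaJ J p x y' := by
  have h := mdifferentiableAt_extend 𝓘(ℝ, E) E y
  have h' := mdifferentiableAt_extend 𝓘(ℝ, E) E y'
  have h1 := g.nablaJ_apply J x (mdifferentiableAt_add_section h h')
  have h2 : (fun q ↦ J.val q ((extend E y + extend E y' : Π q : M, TangentSpace 𝓘(ℝ, E) q) q))
      = (fun q ↦ J.val q (extend E y q)) + fun q ↦ J.val q (extend E y' q) := by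
    ext q; simp
  rw [h2, g.leviCivita.isCovariantDerivativeOnUniv.add h h',
    g.leviCivita.isCovariantDerivativeOnUniv.add (mdifferentiableAt_almostComplex h)
      (mdifferentiableAt_almostComplex h')] at h1
  simp only [Pi.add_apply, extend_apply_self, add_apply, map_add] at h1
  rw [h1]
  simp only [nablaJ]
  abel

theorem nablaJ_smul_right (c : ℝ) (x y : TangentSpace 𝓘(ℝ, E) p) :
    g.nablaJ J p x (c • y) = c • g.nablaJ J p x y := by
  have h := mdifferentiableAt_extend 𝓘(ℝ, E) E y
  have h1 := g.nablaJ_apply J x (Y := (fun _ : M ↦ c) • extend E y)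
    (mdifferentiableAt_const.smul_section h)
  have h0 : ((fun _ : M ↦ c) • extend E y : Π q : M, TangentSpace 𝓘(ℝ, E) q) = c • extend E y := rfl
  rw [h0] at h1
  have h2 : (fun q ↦ J.val q ((c • extend E y : Π q : M, TangentSpace 𝓘(ℝ, E) q) q))
      = c • fun q ↦ J.val q (extend E y q) := by
    ext q; simp
  rw [h2, g.leviCivita.isCovariantDerivativeOnUniv.smul_const c h,
    g.leviCivita.isCovariantDerivativeOnUniv.smul_const c (mdifferentiableAt_almostComplex h)] at h1
  simp only [Pi.smul_apply, extend_apply_self, smul_apply, map_smul] at h1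
  rw [h1]
  simp only [nablaJ, smul_sub]

variable (g J) in
/-- The tensor `∇J` at a point as a bilinear map. -/
noncomputable def nablaJₗ (p : M) : TangentSpace 𝓘(ℝ, E) p →ₗ[ℝ] TangentSpace 𝓘(ℝ, E) p →ₗ[ℝ]
    TangentSpace 𝓘(ℝ, E) p :=
  LinearMap.mk₂ ℝ (g.nablaJ J p) nablaJ_add_left nablaJ_smul_left nablaJ_add_right nablaJ_smul_right

theorem fundamentalTensor_neg_middle (x y z : TangentSpace 𝓘(ℝ, E) p) :
    g.fundamentalTensor J p x (-y) z = -g.fundamentalTensor J p x y z := by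
  simpa [fundamentalTensor] using congr(g.val p $(nablaJ_smul_right (J := J) (-1) x y) z)

/-- Differentiate J² = -id. -/
theorem nablaJ_almostComplex (x y : TangentSpace 𝓘(ℝ, E) p) :
    g.nablaJ J p x (J.val p y) = -J.val p (g.nablaJ J p x y) := by
  have h := mdifferentiableAt_extend 𝓘(ℝ, E) E y
  have h1 := g.nablaJ_apply J x (mdifferentiableAt_almostComplex (J := J) h)
  have h2 : (fun q ↦ J.val q (J.val q (extend E y q)))
      = (-1 : ℝ) • (extend E y : Π q : M, TangentSpace 𝓘(ℝ, E) q) := by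
    ext q; simp [J.sq_eq_neg]
  rw [h2, g.leviCivita.isCovariantDerivativeOnUniv.smul_const (-1) h] at h1
  simp only [extend_apply_self] at h1
  rw [h1]
  simp [nablaJ, J.sq_eq_neg, sub_eq_add_neg]

/-! ### Norden and quasi-Kähler identities, holomorphic curvature -/

namespace IsNorden

variable (hN : g.IsNorden J)
include hN

omit [FiniteDimensional ℝ E] in
theorem val_apply_left (x y : TangentSpace 𝓘(ℝ, E) p) :
    g.val p (J.val p x) y = g.val p x (J.val p y) := by
  have := hN p x (J.val p y)
  rw [J.sq_eq_neg] at this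
  simpa using this

/-- For a Norden metric J is g-self-adjoint; differentiating g(JY, Z) = g(Y, JZ) shows that ∇_x J is
self-adjoint too. -/
theorem fundamentalTensor_symm (x y z : TangentSpace 𝓘(ℝ, E) p) :
    g.fundamentalTensor J p x y z = g.fundamentalTensor J p x z y := by
  have hx := mdifferentiableAt_extend 𝓘(ℝ, E) E x
  have hy := mdifferentiableAt_extend 𝓘(ℝ, E) E y
  have hz := mdifferentiableAt_extend 𝓘(ℝ, E) E z
  have h1 := mvfderiv_pair_eq (g := g) hx (mdifferentiableAt_almostComplex (J := J) hy) hz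
  have h2 := mvfderiv_pair_eq (g := g) hx hy (mdifferentiableAt_almostComplex (J := J) hz)
  have h3 : g.pair (fun q ↦ J.val q (extend E y q)) (extend E z)
      = g.pair (extend E y) (fun q ↦ J.val q (extend E z q)) := by
    ext q; exact hN.val_apply_left _ _
  rw [h3, h2] at h1
  simp only [extend_apply_self] at h1
  simp only [fundamentalTensor, nablaJ, map_sub, sub_apply, hN.val_apply_left]
  rw [hN.val_apply_left, g.symm p y] at h1
  rw [g.symm p _ (J.val p y), hN.val_apply_left]
  linarith

theorem fundamentalTensor_almostComplex (x y z : TangentSpace 𝓘(ℝ, E) p) :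
    g.fundamentalTensor J p x (J.val p y) (J.val p z) = g.fundamentalTensor J p x y z := by
  simp [fundamentalTensor, nablaJ_almostComplex, hN p]

omit hN in
theorem fundamentalTensor_apply (x z : TangentSpace 𝓘(ℝ, E) p) (hY : MDiffAt (T% Y) p) :
    g.fundamentalTensor J p x (Y p) z = g.val p (g.leviCivita (fun q ↦ J.val q (Y q)) p x) z
      - g.val p (J.val p (g.leviCivita Y p x)) z := by
  rw [fundamentalTensor, g.nablaJ_apply J x hY, map_sub, sub_apply]

theorem fundamentalTensor_self (hW : g.IsW₃ J) (x y : TangentSpace 𝓘(ℝ, E) p) :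
    g.fundamentalTensor J p y x x = -2 * g.fundamentalTensor J p x x y := by
  have := hW p y x x
  rw [hN.fundamentalTensor_symm x y x] at this
  linarith

/-- On a quasi-Kähler manifold with Norden metric,
`R(x, Jx, x, Jx) = -g((∇_x J)x, (∇_x J)x)`. -/
theorem curvature₄_holomorphic (hW : g.IsW₃ J) (x : TangentSpace 𝓘(ℝ, E) p) :
    g.curvature₄ p x (J.val p x) x (J.val p x)
      = -g.val p (g.nablaJ J p x x) (g.nablaJ J p x x) := by
  have hn : (∞ : WithTop ℕ∞) ≠ 0 := by simp
  rw [curvature₄, curvature]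
  set X : Π q : M, TangentSpace 𝓘(ℝ, E) q := extend E x
  -- Y agrees with JX at p only, so ∇_X Y and ∇_X(JX) must be kept apart.
  set Y : Π q : M, TangentSpace 𝓘(ℝ, E) q := extend E (J.val p x)
  have hX : CMDiffAt ∞ (T% X) p := contMDiffAt_extend 𝓘(ℝ, E) E x
  have hY : CMDiffAt ∞ (T% Y) p := contMDiffAt_extend 𝓘(ℝ, E) E (J.val p x)
  have hXp : X p = x := extend_apply_self E x
  have hYp : Y p = J.val p x := extend_apply_self E _
  have hJX := contMDiffAt_almostComplex (J := J) hX
  have hJY := contMDiffAt_almostComplex (J := J) hY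
  have hJJX := contMDiffAt_almostComplex (J := J) hJX
  have hXX := g.contMDiffAt_leviCivita hX hX
  have hXJX := g.contMDiffAt_leviCivita hX hJX
  have hYX := g.contMDiffAt_leviCivita hY hX
  have hYJX := g.contMDiffAt_leviCivita hY hJX
  have hF : ∀ q (u z : TangentSpace 𝓘(ℝ, E) q), MDiffAt (T% X) q →
      g.fundamentalTensor J q u (X q) z
        = g.val q (g.leviCivita (fun q ↦ J.val q (X q)) q u) z
          - g.val q (g.leviCivita X q u) (J.val q z) := by
    intro q u z h
    rw [fundamentalTensor_apply u z h, hN.val_apply_left]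
  have hX' := eventually_mdifferentiableAt hX
  -- F(X,X,X) = 0, as an identity near p that can be differentiated.
  have e1 : g.pair (fun q ↦ g.leviCivita (fun q ↦ J.val q (X q)) q (X q)) X
      - g.pair (fun q ↦ g.leviCivita X q (X q)) (fun q ↦ J.val q (X q)) =ᶠ[nhds p] 0 := by
    filter_upwards [hX'] with q hq
    have := hF q (X q) (X q) hq
    have h2 := hN.fundamentalTensor_self hW (X q) (X q)
    simp only [Pi.sub_apply, pair, Pi.zero_apply]
    linarith
  -- F(X,X,JX) = 0: J-invariance in the last two slots sends it to its own negative.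
  have e2 : g.pair (fun q ↦ g.leviCivita (fun q ↦ J.val q (X q)) q (X q)) (fun q ↦ J.val q (X q))
      - g.pair (fun q ↦ g.leviCivita X q (X q)) (fun q ↦ J.val q (J.val q (X q)))
        =ᶠ[nhds p] 0 := by
    filter_upwards [hX'] with q hq
    have h1 := hF q (X q) (J.val q (X q)) hq
    have h2 := hN.fundamentalTensor_almostComplex (X q) (X q) (J.val q (X q))
    rw [J.sq_eq_neg, hN.fundamentalTensor_symm] at h2
    simp only [fundamentalTensor_neg_middle] at h2
    simp only [Pi.sub_apply, pair, Pi.zero_apply]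
    linarith
  -- F(Y,X,X) + 2F(X,X,Y) = 0. Differentiating F(X,X,Y) along X yields the same second derivatives
  -- at p as differentiating F(X,X,JX), which `e2` controls.
  have e3 : (g.pair (fun q ↦ g.leviCivita (fun q ↦ J.val q (X q)) q (Y q)) X
      - g.pair (fun q ↦ g.leviCivita X q (Y q)) (fun q ↦ J.val q (X q)))
      + ((g.pair (fun q ↦ g.leviCivita (fun q ↦ J.val q (X q)) q (X q)) Y
      - g.pair (fun q ↦ g.leviCivita X q (X q)) (fun q ↦ J.val q (Y q)))
      + (g.pair (fun q ↦ g.leviCivita (fun q ↦ J.val q (X q)) q (X q)) Y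
      - g.pair (fun q ↦ g.leviCivita X q (X q)) (fun q ↦ J.val q (Y q))))
        =ᶠ[nhds p] 0 := by
    filter_upwards [hX'] with q hq
    have h1 := hF q (X q) (Y q) hq
    have h2 := hF q (Y q) (X q) hq
    have h3 := hN.fundamentalTensor_self hW (X q) (Y q)
    simp only [Pi.add_apply, Pi.sub_apply, pair, Pi.zero_apply]
    linarith
  have d1 := mvfderiv_pair_sub_pair (g := g) hY hXJX hX hXX hJX
  have d2 := mvfderiv_pair_sub_pair (g := g) hX hXJX hJX hXX hJJX
  have d3 := mvfderiv_pair_sub_pair (g := g) hX hYJX hX hYX hJX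
  have d4 := mvfderiv_pair_sub_pair (g := g) hX hXJX hY hXX hJY
  have d5 := congr($(mvfderiv_eq_zero_of_eventuallyEq e3) (X p))
  have m3 := (contMDiffAt_pair_sub_pair (g := g) hYJX hX hYX hJX).mdifferentiableAt hn
  have m4 := (contMDiffAt_pair_sub_pair (g := g) hXJX hY hXX hJY).mdifferentiableAt hn
  rw [mvfderiv_add m3 (m4.add m4), mvfderiv_add m4 m4, add_apply, add_apply, d3, d4] at d5
  rw [mvfderiv_eq_zero_of_eventuallyEq e1] at d1
  rw [mvfderiv_eq_zero_of_eventuallyEq e2] at d2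
  have hskew := val_curvature_skew (g := g) hX hY hJX hX
  have htors := leviCivita_torsion_free (g := g) (hX.mdifferentiableAt hn)
    (hY.mdifferentiableAt hn)
  have hXd := hX.mdifferentiableAt hn
  have b1 := hF p (VectorField.mlieBracket 𝓘(ℝ, E) X Y p) (X p) hXd
  rw [hN.fundamentalTensor_self hW, hF p _ _ hXd, ← htors] at b1
  have j1 := g.nablaJ_apply J (X p) (hY.mdifferentiableAt hn)
  have j2 := g.nablaJ_apply J (X p) (hJX.mdifferentiableAt hn)
  have j3 := g.nablaJ_apply J (X p) hXd
  rw [eq_comm, sub_eq_iff_eq_add] at j1 j2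
  have f1 := hF p (X p) (g.leviCivita (fun q ↦ J.val q (X q)) p (X p)) hXd
  have f2 := hF p (Y p) (g.leviCivita X p (X p)) hXd
  -- The identity F(Jx,x,w) = F(x,x,Jw): in the cyclic sum for (Jx,x,w), the term F(w,Jx,x)
  -- vanishes.
  have f3 : g.fundamentalTensor J p (Y p) (X p) (g.leviCivita X p (X p))
      = g.fundamentalTensor J p (X p) (X p) (J.val p (g.leviCivita X p (X p))) := by
    have h1 := hW p (J.val p x) x (g.leviCivita X p (X p))
    have h2 := hN.fundamentalTensor_almostComplex (g.leviCivita X p (X p)) x (J.val p x)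
    have h3 := hN.fundamentalTensor_almostComplex x (J.val p x) (g.leviCivita X p (X p))
    rw [J.sq_eq_neg, hN.fundamentalTensor_symm, fundamentalTensor_neg_middle,
      hN.fundamentalTensor_symm] at h2
    rw [J.sq_eq_neg, fundamentalTensor_neg_middle] at h3
    rw [hN.fundamentalTensor_symm x] at h1
    rw [hXp, hYp]
    rw [hXp] at h1 h2 h3
    linarith
  have f4 := hF p (X p) (J.val p (g.leviCivita X p (X p))) hXd
  have s1 := g.symm p (J.val p (X p))
  have s2 := g.symm p (g.leviCivita X p (X p))
    (g.leviCivita (fun q ↦ J.val q (X q)) p (Y p))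
  have s3 := g.symm p (g.leviCivita (fun q ↦ J.val q (X q)) p (X p))
    (g.leviCivita X p (Y p))
  have s4 := g.symm p (g.leviCivita (fun q ↦ J.val q (X q)) p (X p))
    (J.val p (g.leviCivita X p (X p)))
  have s5 := hN.val_apply_left (g.leviCivita X p (X p)) (J.val p (g.leviCivita X p (X p)))
  have s6 := hN.val_apply_left (g.leviCivita X p (Y p)) (g.leviCivita X p (X p))
  have s7 := g.symm p (J.val p (g.leviCivita X p (Y p))) (g.leviCivita X p (X p))
  have s8 := hN.val_apply_left (g.leviCivita X p (X p))
    (g.leviCivita (fun q ↦ J.val q (X q)) p (X p))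
  rw [← htors, s1] at hskew
  rw [← htors]
  simp only [hXp, hYp] at d1 d2 d5 hskew b1 j1 j2 j3 f1 f2 f3 f4 s2 s3 s4 s5 s6 s7 s8 ⊢
  rw [j1] at d5
  rw [j2] at d2
  rw [j3]
  simp only [map_add, map_sub, sub_apply, zero_apply]
    at d1 d2 d5 hskew b1 f1 f2 f3 f4 ⊢
  linarith

end IsNorden

end PseudoRiemannianMetric

/-! ### Polarization and contraction at a point -/

section LinearAlgebra

variable {V : Type*} [AddCommGroup V] [Module ℝ V] {ι : Type*} [Fintype ι]
  {B : V →ₗ[ℝ] V →ₗ[ℝ] ℝ} {A : V →ₗ[ℝ] V →ₗ[ℝ] V} {e : Basis ι ℝ V} {f : ι → V}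

/-- The polarization of the identity `B (A x x) (A x x) = 0`. -/
theorem polarization_of_apply_self_eq_zero (hB : ∀ x y, B x y = B y x)
    (h : ∀ x, B (A x x) (A x x) = 0) (x x' y y' : V) :
    B (A x x' + A x' x) (A y y' + A y' y) + B (A x y + A y x) (A x' y' + A y' x')
      + B (A x y' + A y' x) (A x' y + A y x') = 0 := by
  -- The part of the quartic identity even in y; `h2` polarizes it in x, and the end of the proof in
  -- y.
  have h1 : ∀ x y, 2 * B (A x x) (A y y) + B (A x y + A y x) (A x y + A y x) = 0 := by
    intro x y
    have h2 := h (x + y)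
    have h3 := h (x - y)
    have h4 := hB (A x x) (A y y)
    simp only [map_add, map_sub, LinearMap.add_apply, LinearMap.sub_apply] at h2 h3 ⊢
    linarith [h x, h y]
  have h2 : ∀ x x' y, B (A x x' + A x' x) (A y y) + B (A x y + A y x) (A x' y + A y x') = 0 := by
    intro x x' y
    have h3 := h1 (x + x') y
    have h4 := h1 x y
    have h5 := h1 x' y
    have h6 := hB (A x y + A y x) (A x' y + A y x')
    simp only [map_add, LinearMap.add_apply] at h3 h4 h5 h6 ⊢
    linarith
  have h3 := h2 x x' (y + y')
  have h4 := h2 x x' y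
  have h5 := h2 x x' y'
  simp only [map_add, LinearMap.add_apply] at h3 h4 h5 ⊢
  linarith

variable [DecidableEq ι]

theorem sum_apply_smul_dual (hB : ∀ x, (∀ y, B x y = 0) → x = 0)
    (hf : ∀ i j, B (f i) (e j) = if i = j then 1 else 0) (v : V) :
    ∑ m, B v (e m) • f m = v := by
  rw [← sub_eq_zero]
  refine hB _ fun y ↦ ?_
  have : B (∑ m, B v (e m) • f m - v) = 0 := e.ext fun j ↦ by simp [hf]
  rw [this, LinearMap.zero_apply]

theorem sum_mul_dual (hB : ∀ x, (∀ y, B x y = 0) → x = 0) (hs : ∀ x y, B x y = B y x)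
    (hf : ∀ i j, B (f i) (e j) = if i = j then 1 else 0) (u v : V) :
    ∑ m, B u (e m) * B v (f m) = B u v := by
  conv_rhs => rw [← sum_apply_smul_dual hB hf u]
  simp [hs v]

/-- The tensor ∑ eᵢ ⊗ fᵢ is the inverse metric, hence symmetric. -/
theorem sum_apply_dual_comm {W : Type*} [AddCommGroup W] [Module ℝ W]
    (hB : ∀ x, (∀ y, B x y = 0) → x = 0) (hs : ∀ x y, B x y = B y x)
    (hf : ∀ i j, B (f i) (e j) = if i = j then 1 else 0) (C : V →ₗ[ℝ] V →ₗ[ℝ] W) :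
    ∑ i, C (e i) (f i) = ∑ i, C (f i) (e i) := by
  have h1 : ∀ i, C (e i) (f i) = ∑ m, B (e i) (e m) • C (f m) (f i) := fun i ↦ by
    conv_lhs => rw [← sum_apply_smul_dual hB hf (e i)]
    simp
  have h2 : ∀ i, C (f i) (e i) = ∑ m, B (e i) (e m) • C (f i) (f m) := fun i ↦ by
    conv_lhs => rw [← sum_apply_smul_dual hB hf (e i)]
    simp
  simp only [h1, h2]
  rw [Finset.sum_comm]
  simp only [hs]

theorem sum_apply_dual_eq_trace
    (hs : ∀ x y, B x y = B y x)
    (hf : ∀ i j, B (f i) (e j) = if i = j then 1 else 0) (T : V →ₗ[ℝ] V) :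
    ∑ i, B (T (e i)) (f i) = LinearMap.trace ℝ V T := by
  rw [LinearMap.trace_eq_matrix_trace ℝ e, Matrix.trace]
  refine Finset.sum_congr rfl fun i _ ↦ ?_
  rw [Matrix.diag_apply, LinearMap.toMatrix_apply]
  conv_lhs => rw [← e.sum_repr (T (e i)), hs]
  simp only [map_sum, map_smul, hf]
  simp

/-- T = JTJ, so cyclicity gives tr T = tr(TJ²) = -tr T. -/
theorem trace_eq_zero_of_anticommute {J T : V →ₗ[ℝ] V} (hJ : ∀ x, J (J x) = -x)
    (h : ∀ x, T (J x) = -J (T x)) : LinearMap.trace ℝ V T = 0 := by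
  have h1 : T = -(T * J * J) := by ext x; simp [hJ]
  have h2 : T = J * (T * J) := by ext x; simp [hJ, h]
  have h3 := LinearMap.trace_mul_comm ℝ J (T * J)
  rw [← h2] at h3
  have h4 := congr(LinearMap.trace ℝ V $h1)
  rw [map_neg, ← h3] at h4
  linarith

/-- Two contractions, N + 2N* = 0 (`hN`) and N + N* = 0 (`hp`), force N = 0; here N* is the sum of
B(A(eᵢ,eₖ), A(fₖ,fᵢ)). -/
theorem sum_apply_apply_dual_eq_zero
    (hB : ∀ x, (∀ y, B x y = 0) → x = 0) (hs : ∀ x y, B x y = B y x)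
    (hf : ∀ i j, B (f i) (e j) = if i = j then 1 else 0)
    {J : V →ₗ[ℝ] V} (hJ : ∀ x, J (J x) = -x) (hA : ∀ x y, A x (J y) = -J (A x y))
    (hsymm : ∀ x y z, B (A x y) z = B (A x z) y)
    (hcyc : ∀ x y z, B (A x y) z + B (A y z) x + B (A z x) y = 0)
    (h : ∀ x, B (A x x) (A x x) = 0) :
    ∑ i, ∑ k, B (A (e i) (e k)) (A (f i) (f k)) = 0 := by
  -- Contracting the cyclic identity gives twice the pairing of this trace with w plus tr A(w,·),
  -- and A(w,·) anticommutes with J.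
  have htr : ∑ i, A (e i) (f i) = 0 := by
    refine hB _ fun w ↦ ?_
    have h1 : ∑ i, (B (A (e i) (f i)) w + B (A (f i) (e i)) w + B (A w (e i)) (f i)) = 0 :=
      Finset.sum_eq_zero fun i _ ↦ by
        rw [hsymm (f i), ← hcyc (e i) (f i) w]
    have h2 := sum_apply_dual_comm hB hs hf (A.compr₂ (B.flip w))
    simp only [LinearMap.compr₂_apply, LinearMap.flip_apply] at h2
    rw [Finset.sum_add_distrib, Finset.sum_add_distrib, ← h2,
      sum_apply_dual_eq_trace hs hf, trace_eq_zero_of_anticommute hJ (hA w)] at h1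
    simp only [map_sum, LinearMap.sum_apply]
    linarith
  have hN : ∑ i, ∑ k, B (A (e i) (e k)) (A (f i) (f k))
      + 2 * ∑ i, ∑ k, B (A (e i) (e k)) (A (f k) (f i)) = 0 := by
    -- Contract the cyclic identity with the tensor itself: the first term gives N, the other two N*
    -- each.
    have h0 : ∑ i, ∑ k, ∑ m, B (A (e i) (e k)) (e m) * (B (A (f i) (f k)) (f m)
        + B (A (f k) (f m)) (f i) + B (A (f m) (f i)) (f k)) = 0 := by simp [hcyc]
    have h1 : ∑ i, ∑ k, ∑ m, B (A (e i) (e k)) (e m) * B (A (f m) (f i)) (f k)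
        = ∑ i, ∑ k, B (A (e i) (e k)) (A (f k) (f i)) := by
      refine Finset.sum_congr rfl fun i _ ↦ ?_
      rw [Finset.sum_comm]
      refine Finset.sum_congr rfl fun m _ ↦ ?_
      rw [← sum_mul_dual hB hs hf]
      exact Finset.sum_congr rfl fun k _ ↦ by rw [hsymm (e i)]
    simp only [mul_add, Finset.sum_add_distrib, h1] at h0
    simp only [hsymm (f _) (f _) (f _), sum_mul_dual hB hs hf] at h0
    linarith
  have hS : ∑ i, ∑ k, B (A (e i) (e k) + A (e k) (e i)) (A (f i) (f k) + A (f k) (f i))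
      = 2 * ∑ i, ∑ k, B (A (e i) (e k)) (A (f i) (f k))
        + 2 * ∑ i, ∑ k, B (A (e i) (e k)) (A (f k) (f i)) := by
    have h1 : ∑ i, ∑ k, B (A (e k) (e i)) (A (f k) (f i))
        = ∑ i, ∑ k, B (A (e i) (e k)) (A (f i) (f k)) := Finset.sum_comm
    have h2 : ∑ i, ∑ k, B (A (e k) (e i)) (A (f i) (f k))
        = ∑ i, ∑ k, B (A (e i) (e k)) (A (f k) (f i)) := Finset.sum_comm
    simp only [map_add, LinearMap.add_apply, Finset.sum_add_distrib, h1, h2]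
    ring
  have hS' : ∑ i, ∑ k, B (A (e i) (f k) + A (f k) (e i)) (A (f i) (e k) + A (e k) (f i))
      = ∑ i, ∑ k, B (A (e i) (e k) + A (e k) (e i)) (A (f i) (f k) + A (f k) (f i)) := by
    refine Finset.sum_congr rfl fun i _ ↦ ?_
    have := sum_apply_dual_comm hB hs hf
      (B.compl₁₂ (A (e i) + A.flip (e i)) (A (f i) + A.flip (f i)))
    simpa using this.symm
  have h0 : ∑ i, ∑ k, B (A (e i) (f i) + A (f i) (e i)) (A (e k) (f k) + A (f k) (e k)) = 0 := by
    have h1 := sum_apply_dual_comm hB hs hf A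
    simp only [← map_sum, ← LinearMap.sum_apply, Finset.sum_add_distrib, ← h1, htr]
    simp
  -- Polarization at (eᵢ, fᵢ, eₖ, fₖ): the first term drops by `htr`, and the other two sums both
  -- equal 2N + 2N*.
  have hp : ∑ i, ∑ k, (B (A (e i) (f i) + A (f i) (e i)) (A (e k) (f k) + A (f k) (e k))
      + B (A (e i) (e k) + A (e k) (e i)) (A (f i) (f k) + A (f k) (f i))
      + B (A (e i) (f k) + A (f k) (e i)) (A (f i) (e k) + A (e k) (f i))) = 0 :=
    Finset.sum_eq_zero fun i _ ↦ Finset.sum_eq_zero fun k _ ↦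
      polarization_of_apply_self_eq_zero hs h _ _ _ _
  simp only [Finset.sum_add_distrib] at hp
  rw [h0, hS', hS] at hp
  linarith

end LinearAlgebra

/-! ### From the pointwise algebra to the manifold -/

namespace PseudoRiemannianMetric

variable {E : Type*} [NormedAddCommGroup E] [NormedSpace ℝ E] [FiniteDimensional ℝ E]
  {M : Type*} [TopologicalSpace M] [ChartedSpace E M] [IsManifold 𝓘(ℝ, E) ∞ M]
  (g : PseudoRiemannianMetric E M) {p : M}

/-- The metric at a point as a bilinear form. -/
noncomputable def valₗ (p : M) :
    TangentSpace 𝓘(ℝ, E) p →ₗ[ℝ] TangentSpace 𝓘(ℝ, E) p →ₗ[ℝ] ℝ :=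
  LinearMap.mk₂ ℝ (fun x y ↦ g.val p x y) (by simp) (by simp) (by simp) (by simp)

omit [FiniteDimensional ℝ E] in
theorem isUnit_det_gram {ι : Type*} [Fintype ι] [DecidableEq ι]
    (e : Basis ι ℝ (TangentSpace 𝓘(ℝ, E) p)) : IsUnit (g.gram e).det := by
  rw [isUnit_iff_ne_zero]
  intro hdet
  obtain ⟨v, hv, hv'⟩ := Matrix.exists_vecMul_eq_zero_iff.2 hdet
  apply hv
  have h0 : ∑ j, v j • e j = 0 := by
    refine g.nondegenerate p _ fun w ↦ ?_
    have h1 : g.valₗ p (∑ j, v j • e j) = 0 := e.ext fun i ↦ by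
      simpa [valₗ, gram, Matrix.vecMul, dotProduct] using congr_fun hv' i
    exact congr($h1 w)
  ext j
  exact (Fintype.linearIndependent_iff.1 e.linearIndependent) v h0 j

/-- The inverse Gram matrix is absorbed into the dual vectors fᵢ = gⁱʲeⱼ, giving the form of the sum
in the algebraic half. -/
theorem sqNormNablaJ_eq_sum_dual {J : AlmostComplexStructure E M} {ι : Type*} [Fintype ι]
    [DecidableEq ι] (e : Basis ι ℝ (TangentSpace 𝓘(ℝ, E) p)) :
    g.sqNormNablaJ J e = ∑ i, ∑ k, g.valₗ p (g.nablaJₗ J p (e i) (e k))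
      (g.nablaJₗ J p (∑ j, (g.gram e)⁻¹ i j • e j) (∑ l, (g.gram e)⁻¹ k l • e l)) := by
  simp only [map_sum, map_smul, LinearMap.sum_apply, LinearMap.smul_apply, Finset.smul_sum,
    smul_smul, sqNormNablaJ, smul_eq_mul]
  refine Finset.sum_congr rfl fun i _ ↦ ?_
  rw [Finset.sum_comm]
  refine Finset.sum_congr rfl fun k _ ↦ ?_
  rw [Finset.sum_comm]
  simp only [valₗ, nablaJₗ, LinearMap.mk₂_apply]
  exact Finset.sum_congr rfl fun l _ ↦ Finset.sum_congr rfl fun j _ ↦ by ring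

theorem isIsotropicKahler_of_val_nablaJ_self_eq_zero {J : AlmostComplexStructure E M}
    (hN : g.IsNorden J) (hW : g.IsW₃ J)
    (h : ∀ (p : M) (x : TangentSpace 𝓘(ℝ, E) p),
      g.val p (g.nablaJ J p x x) (g.nablaJ J p x x) = 0) : g.IsIsotropicKahler J := by
  intro p e
  rw [sqNormNablaJ_eq_sum_dual]
  refine sum_apply_apply_dual_eq_zero (B := g.valₗ p) (A := g.nablaJₗ J p) (e := e)
    (f := fun i ↦ ∑ j, (g.gram e)⁻¹ i j • e j) (J := (J.val p).toLinearMap)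
    (g.nondegenerate p) (g.symm p) ?_ (J.sq_eq_neg p) nablaJ_almostComplex
    hN.fundamentalTensor_symm (hW p) (h p)
  intro i j
  have h1 := congr($(Matrix.nonsing_inv_mul _ (g.isUnit_det_gram e)) i j)
  rw [Matrix.mul_apply, Matrix.one_apply] at h1
  rw [← h1]
  simp [valₗ, gram]

end PseudoRiemannianMetric

theorem theoremt22 {E : Type*} [NormedAddCommGroup E] [NormedSpace ℝ E] [FiniteDimensional ℝ E]
    {M : Type*} [TopologicalSpace M] [ChartedSpace E M] [IsManifold 𝓘(ℝ, E) ∞ M]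
    (hdim : 4 ≤ finrank ℝ E)
    (g : PseudoRiemannianMetric E M) (J : AlmostComplexStructure E M)
    (hN : g.IsNorden J) (hW : g.IsW₃ J)
    (hR : ∀ (p : M) (x y : TangentSpace 𝓘(ℝ, E) p),
      g.curvature₄ p x (J.val p x) y (J.val p y) = 0) :
    g.IsIsotropicKahler J := by
  refine g.isIsotropicKahler_of_val_nablaJ_self_eq_zero hN hW fun p x ↦ ?_
  have h1 := hN.curvature₄_holomorphic hW x
  -- Only the holomorphic case y = x of the curvature condition enters.
  rw [hR p x x] at h1
  linarith
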